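/- A signal machine consists of a finite set $M$ of meta-signals, a speed function $s\colon M\to\mathbb R$, and a collision function that maps every set $C^-\subseteq M$ with at least two elements and pairwise distinct speeds to a set $C^+\subseteq M$ with pairwise distinct speeds (the pair $C^-\to C^+$ is called a rule). A configuration assigns to each point of $\mathbb R$ either a meta-signal (a signal), a rule (a collision), the value "void" or the value "accumulation". An initial configuration has finitely many non-void positions and no accumulation; it may also have several signals with distinct speeds at the same position. From an initial configuration $c_0$ the machine evolves as follows. A signal $\mu$ moves with constant speed $s(\mu)$ until it meets another signal. When the signals that arrive at a position form a set $C^-$ of at least two meta-signals, there is a collision $C^-\to C^+$ there, and the signals of $C^+$ leave that position in place of those of $C^-$. Let $t_0=0$, and let $t_{n+1}=t_n+\Delta_n$, where $\Delta_n\in(0,\infty]$ is the time from $t_n$ to the next collision; let $T=\lim_n t_n$, with $T=\infty$ if some $\Delta_n$ is infinite. This defines the space-time diagram at all times $0\le t<T$. If $T<\infty$, the diagram is also defined at time $T$, where the position $x$ has the value "accumulation" if $(x,T)$ is a limit of collisions that happen before $T$. At every time, a position that carries neither a collision nor a signal and is an accumulation point of non-void positions also has the value "accumulation". Two real numbers $a,b$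 are commensurate if $ma=nb$ for some integers $m,n$ that are not both $0$ (that is, their ratio is rational; $0$ is commensurate with every number). A signal machine is rational-like if its speeds are pairwise commensurate. A configuration is rational-like if the distances between its non-void positions are pairwise commensurate. **Theorem.** A rational-like signal machine with exactly $3$ distinct speeds never produces an accumulation when it is started from a rational-like initial configuration: $T=\infty$, so that the space-time diagram is defined at all times $t\ge 0$; the value "accumulation" occurs nowhere in it; and the set of the points $(x,t)$ of space-time at which there is a collision has no accumulation point in $\mathbb R^2$. -/

import Mathlib

open scoped ENNReal

/-- A signal machine on a finite set `M` of meta-signals: a real speed for every meta-signal and a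
collision function on sets of meta-signals, which maps each set of at least two meta-signals with
pairwise distinct speeds to a set of meta-signals with pairwise distinct speeds. -/
structure SignalMachine (M : Type*) [Finite M] where
  speed : M → ℝ
  collide : Set M → Set M
  collide_injOn : ∀ s : Set M, s.Nontrivial → Set.InjOn speed s → Set.InjOn speed (collide s)

/-- Two real numbers are commensurate: their ratio is rational, written as a nontrivial integer
relation between them. The number `0` is commensurate with every number. -/
def Commensurate (a b : ℝ) : Prop :=
  ∃ m n : ℤ, (m ≠ 0 ∨ n ≠ 0) ∧ m * a = n * b

namespace SignalMachine

variable {M : Type*} [Finite M]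

/-- The number of distinct speeds of a machine. -/
noncomputable def speedCount (S : SignalMachine M) : ℕ := (Set.range S.speed).ncard

/-- A machine is rational-like when its speeds are pairwise commensurate. -/
def RationalLike (S : SignalMachine M) : Prop :=
  ∀ μ ν : M, Commensurate (S.speed μ) (S.speed ν)

/-- A collision rule `C⁻ → C⁺`, given by its incoming set `C⁻`. -/
structure Rule (S : SignalMachine M) where
  incoming : Set M
  nontrivial : incoming.Nontrivial
  injOn : Set.InjOn S.speed incoming

/-- The outgoing set `C⁺` of a collision rule. -/
def Rule.outgoing {S : SignalMachine M} (ρ : S.Rule) : Set M := S.collide ρ.incoming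

/-- What can be found at a position: nothing, an accumulation, a signal, or a collision.
The constructor `start s` is used in initial configurations only: it stands for several signals
`s`, of distinct speeds, placed at the same initial position. -/
inductive Value (S : SignalMachine M) where
  | void : Value S
  | accu : Value S
  | sig (μ : M) : Value S
  | col (ρ : S.Rule) : Value S
  | start (s : Set M) : Value S

/-- The meta-signals of the signals that leave a position having a given value. -/
def Value.out {S : SignalMachine M} : Value S → Set M
  | .void => ∅
  | .accu => ∅
  | .sig μ => {μ}
  | .col ρ => ρ.outgoing
  | .start s => s

/-- The value is a collision. -/
def Value.IsCollision {S : SignalMachine M} (v : Value S) : Prop := ∃ ρ, v = .col ρ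

/-- An assignment of values to the points of space. -/
abbrev Config (S : SignalMachine M) := ℝ → Value S

/-- The positions of a configuration that are not void. -/
def Config.support {S : SignalMachine M} (c : Config S) : Set ℝ := {x | c x ≠ .void}

/-- Initial configurations: finite support, no accumulation, and signals that start at the same
position have distinct speeds. (Non-void positions are isolated because they are finitely many.) -/
structure Config.IsInitial {S : SignalMachine M} (c : Config S) : Prop where
  finite_support : c.support.Finite
  ne_accu : ∀ x, c x ≠ .accu
  start : ∀ x s, c x = .start s → s.Nontrivial ∧ Set.InjOn S.speed s

/-- A configuration is rational-like when the distances between its non-void positions are pairwise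
commensurate. -/
def Config.RationalLike {S : SignalMachine M} (c : Config S) : Prop :=
  ∀ x₁ ∈ c.support, ∀ x₂ ∈ c.support, ∀ x₃ ∈ c.support, ∀ x₄ ∈ c.support,
    Commensurate (dist x₁ x₂) (dist x₃ x₄)

/-- The positive durations after which two signals of `c` that start at different positions would
meet if nothing stopped them. -/
def meetingDelays (S : SignalMachine M) (c : Config S) : Set ℝ :=
  {d | 0 < d ∧ ∃ x₁ x₂ : ℝ, ∃ μ₁ μ₂ : M, x₁ ≠ x₂ ∧ μ₁ ∈ (c x₁).out ∧ μ₂ ∈ (c x₂).out ∧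
    x₁ + d * S.speed μ₁ = x₂ + d * S.speed μ₂}

/-- The time to the next collision; it is `⊤` when there is none. (When the support of `c` is
finite, the infimum is a minimum.) -/
noncomputable def delta (S : SignalMachine M) (c : Config S) : ℝ≥0∞ :=
  ⨅ d ∈ S.meetingDelays c, ENNReal.ofReal d

open Classical in
/-- The configuration in which exactly the signals `A x` arrive at each position `x`: first the
collisions are set, then the signals, then the static accumulations; the rest is void. -/
noncomputable def settle (S : SignalMachine M) (A : ℝ → Set M) : Config S := fun x =>
  if h : (A x).Nontrivial ∧ Set.InjOn S.speed (A x) then .col ⟨A x, h.1, h.2⟩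
  else if h : ∃ μ, A x = {μ} then .sig h.choose
  else if AccPt x (Filter.principal {y | (A y).Nonempty}) then .accu
  else .void

/-- The configuration obtained from `c` after a duration `d`, for `d` positive and not larger than
the time to the next collision. -/
noncomputable def evolve (S : SignalMachine M) (c : Config S) (d : ℝ) : Config S :=
  S.settle fun x => {μ | μ ∈ (c (x - d * S.speed μ)).out}

/-- The collision times `t₀ = 0`, `tₙ₊₁ = tₙ + Δ`, with the configurations at these times. When
there is no further collision, the next times are `⊤` (and the configuration has no meaning). -/
noncomputable def stage (S : SignalMachine M) (c₀ : Config S) : ℕ → ℝ≥0∞ × Config S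
  | 0 => (0, c₀)
  | n + 1 =>
    let p := stage S c₀ n
    (p.1 + S.delta p.2, S.evolve p.2 (S.delta p.2).toReal)

/-- The limit of the collision times; it is `⊤` when there are finitely many of them. -/
noncomputable def limitTime (S : SignalMachine M) (c₀ : Config S) : ℝ≥0∞ :=
  ⨆ n, (S.stage c₀ n).1

open Classical in
/-- The space-time diagram generated from `c₀`, at times `0 ≤ t < limitTime`; void elsewhere. -/
noncomputable def diagramBefore (S : SignalMachine M) (c₀ : Config S) (t : ℝ) : Config S :=
  if h : 0 ≤ t ∧ ∃ n, (S.stage c₀ n).1 ≤ ENNReal.ofReal t ∧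
      ENNReal.ofReal t < (S.stage c₀ (n + 1)).1 then
    let p := S.stage c₀ (Nat.find h.2)
    if t = p.1.toReal then p.2 else S.evolve p.2 (t - p.1.toReal)
  else fun _ => .void

open Classical in
/-- The configuration at a finite limit `T` of the collision times: first the dynamic accumulations,
at the limits of the collisions that precede `T`, then collisions, signals and static
accumulations. -/
noncomputable def limitConfig (S : SignalMachine M) (c₀ : Config S) (T : ℝ) : Config S := fun x =>
  if ∀ ε > 0, ∃ x' t' : ℝ, |x - x'| < ε ∧ T - ε < t' ∧ t' < T ∧
      (S.diagramBefore c₀ t' x').IsCollision then .accu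
  else S.settle (fun y => {μ | ∃ ε > 0, ∀ e : ℝ, 0 < e → e < ε →
      S.diagramBefore c₀ (T - e) (y - e * S.speed μ) = .sig μ}) x

open Classical in
/-- The space-time diagram generated by `S` from `c₀`: at time `t` and position `x`, its value is
`S.diagram c₀ t x`. It is meaningful for `0 ≤ t ≤ limitTime`. -/
noncomputable def diagram (S : SignalMachine M) (c₀ : Config S) (t : ℝ) : Config S :=
  if 0 ≤ t ∧ ENNReal.ofReal t = S.limitTime c₀ then S.limitConfig c₀ t
  else S.diagramBefore c₀ t

/-- The points `(x, t)` of space-time at which there is a collision. -/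
def collisionPoints (S : SignalMachine M) (c₀ : Config S) : Set (ℝ × ℝ) :=
  {p | 0 ≤ p.2 ∧ (S.diagram c₀ p.2 p.1).IsCollision}

end SignalMachine

/-! Write the three speeds as integer multiples `i * u`, `j * u`, `k * u`. The weights `j - k`, `k -
i`, `i - j` make the weighted offsets `y - v * t` of the three speeds `v` sum to zero at every point
`(y, t)`. So if two weighted offsets are multiples of a length `ℓ`, so is the third: lines of two
speeds always cross on a line of the third (`exists_mesh`).

Choose `ℓ` so that the initial positions are nodes of this mesh. Signals then never leave it,
whatever the rules emit, because every collision is at a node (`mem_nodes_of_settle`,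
`aligned_settle`). Nodes are uniformly separated and their times are multiples of some `τ > 0`, so
`t_n ≥ n * τ` and collisions cannot accumulate. Static accumulations are excluded by finiteness of
supports. -/

/-! ### Commensurability and separated sets -/

/-- The members of a finite set of pairwise commensurate real numbers are integer multiples of a
common positive unit. -/
theorem exists_unit_of_pairwise_commensurate {F : Set ℝ} (hF : F.Finite)
    (h : ∀ a ∈ F, ∀ b ∈ F, Commensurate a b) :
    ∃ u : ℝ, 0 < u ∧ ∀ x ∈ F, ∃ n : ℤ, x = n * u := by
  by_cases h0 : ∀ x ∈ F, x = 0
  · exact ⟨1, one_pos, fun x hx => ⟨0, by simp [h0 x hx]⟩⟩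
  push Not at h0
  obtain ⟨d, hd, hd0⟩ := h0
  -- `D` is a common denominator of the ratios `x / d`.
  have key : ∃ D : ℤ, D ≠ 0 ∧ ∀ x ∈ F, ∃ n : ℤ, D * x = n * d := by
    have hc : ∀ x ∈ F, Commensurate x d := fun x hx => h x hx d hd
    clear hd h
    induction F, hF using Set.Finite.induction_on with
    | empty => exact ⟨1, one_ne_zero, by simp⟩
    | @insert a s _ _ ih =>
      obtain ⟨D, hD, hs⟩ := ih fun x hx => hc x (Set.mem_insert_of_mem _ hx)
      obtain ⟨m, n, hmn, e⟩ := hc a (Set.mem_insert _ _)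
      have hm : m ≠ 0 := by
        rintro rfl
        have : (n : ℝ) = 0 := by simpa [hd0] using e.symm
        simp_all
      refine ⟨D * m, mul_ne_zero hD hm, ?_⟩
      rintro x (rfl | hx)
      · exact ⟨D * n, by push_cast; linear_combination (D : ℝ) * e⟩
      · obtain ⟨k, hk⟩ := hs x hx
        exact ⟨m * k, by push_cast; linear_combination (m : ℝ) * hk⟩
  obtain ⟨D, hD, hx⟩ := key
  have hD' : (D : ℝ) ≠ 0 := by exact_mod_cast hD
  refine ⟨|d / D|, abs_pos.2 (div_ne_zero hd0 hD'), fun x hxF => ?_⟩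
  obtain ⟨n, hn⟩ := hx x hxF
  have e : x = n * (d / D) := by field_simp; linear_combination hn
  rcases abs_choice (d / D) with h | h <;> rw [h]
  · exact ⟨n, e⟩
  · exact ⟨-n, by push_cast; linear_combination e⟩

theorem eq_zero_of_mem_zmultiples_of_abs_lt {u r : ℝ} (hr : r ∈ AddSubgroup.zmultiples u)
    (h : |r| < u) : r = 0 := by
  obtain ⟨n, rfl⟩ := AddSubgroup.mem_zmultiples_iff.1 hr
  have hu : 0 < u := (abs_nonneg _).trans_lt h
  rw [zsmul_eq_mul, abs_mul, abs_of_pos hu] at h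
  have h1 : |(n : ℝ)| < 1 := by
    by_contra! h'
    nlinarith
  have h2 : n = 0 := Int.abs_lt_one_iff.1 (by exact_mod_cast h1)
  simp [h2]

/-- A set whose distinct points are uniformly separated has no accumulation point. -/
theorem not_accPt_of_separated {X : Type*} [MetricSpace X] {L : Set X} {ε : ℝ} (hε : 0 < ε)
    (h : ∀ p ∈ L, ∀ q ∈ L, dist p q < ε → p = q) (p : X) :
    ¬ AccPt p (Filter.principal L) := by
  intro hp
  rw [accPt_iff_nhds] at hp
  obtain ⟨q, ⟨hq, hqL⟩, hqp⟩ := hp _ (Metric.ball_mem_nhds p (half_pos hε))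
  -- `r` is taken closer to `p` than `q` is, hence distinct from `q`.
  obtain ⟨r, ⟨hr, hrL⟩, hrp⟩ := hp _ (Metric.ball_mem_nhds p
    (lt_min (half_pos hε) (dist_pos.2 hqp)))
  rw [Metric.mem_ball] at hq hr
  have hqr : q = r := h q hqL r hrL <| by
    have := dist_triangle_right q r p
    have := hr.trans_le (min_le_left _ _)
    linarith
  exact absurd (hr.trans_le (min_le_right _ _)) (by rw [hqr]; exact lt_irrefl _)

namespace SignalMachine

/-! ### Meshes of lines in space-time -/

section Mesh

variable {M : Type*} [Finite M] (S : SignalMachine M)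

/-- A mesh of lines in space-time, given by an origin, a unit of length and a weight for every
meta-signal: the lines of `μ` are those of slope `speed μ` whose offset, multiplied by the weight
of `μ`, is an integer number of units. Two lines of distinct speeds always meet on a line of every
other speed. -/
structure Mesh where
  origin : ℝ
  unit : ℝ
  weight : M → ℤ
  unit_pos : 0 < unit
  weight_ne_zero : ∀ μ, weight μ ≠ 0
  closed : ∀ μ ν κ, S.speed μ ≠ S.speed ν → ∀ y t : ℝ,
    weight μ * (y - S.speed μ * t) ∈ AddSubgroup.zmultiples unit →
    weight ν * (y - S.speed ν * t) ∈ AddSubgroup.zmultiples unit →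
    weight κ * (y - S.speed κ * t) ∈ AddSubgroup.zmultiples unit

namespace Mesh

variable {S} (G : S.Mesh)

/-- The point `(x, t)` lies on a line of the meta-signal `μ`. -/
def OnLine (μ : M) (x t : ℝ) : Prop :=
  G.weight μ * (x - G.origin - S.speed μ * t) ∈ AddSubgroup.zmultiples G.unit

/-- The points of space-time that lie on a line of every meta-signal. -/
def nodes : Set (ℝ × ℝ) := {p | ∀ μ, G.OnLine μ p.1 p.2}

/-- All signals that leave the positions of `c` at time `t` run along lines of the mesh. -/
def Aligned (c : Config S) (t : ℝ) : Prop := ∀ x, ∀ μ ∈ (c x).out, G.OnLine μ x t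

variable {G}

theorem mem_nodes_of_onLine {μ ν : M} (h : S.speed μ ≠ S.speed ν) {x t : ℝ}
    (hμ : G.OnLine μ x t) (hν : G.OnLine ν x t) : (x, t) ∈ G.nodes :=
  fun κ => G.closed μ ν κ h _ t hμ hν

theorem onLine_add {μ : M} {x t d : ℝ} (h : G.OnLine μ (x - d * S.speed μ) t) :
    G.OnLine μ x (t + d) := by
  unfold OnLine at h ⊢
  convert h using 1
  ring

theorem mem_nodes_of_settle {A : ℝ → Set M} {x t : ℝ} (hA : ∀ μ ∈ A x, G.OnLine μ x t)
    (h : (S.settle A x).IsCollision) : (x, t) ∈ G.nodes := by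
  obtain ⟨ρ, hρ⟩ := h
  unfold settle at hρ
  split_ifs at hρ with h1
  obtain ⟨⟨μ, hμ, ν, hν, hne⟩, hinj⟩ := h1
  exact mem_nodes_of_onLine (fun e => hne (hinj hμ hν e)) (hA μ hμ) (hA ν hν)

/-- A node carries a line of every meta-signal, so the outcome of a collision is aligned whatever
its rule. -/
theorem aligned_settle {A : ℝ → Set M} {t : ℝ} (hA : ∀ x, ∀ μ ∈ A x, G.OnLine μ x t) :
    G.Aligned (S.settle A) t := by
  intro x μ hμ
  by_cases hc : (S.settle A x).IsCollision
  · exact mem_nodes_of_settle (hA x) hc μ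
  unfold settle at hμ hc
  split_ifs at hμ hc with h1 h2
  · exact absurd ⟨_, rfl⟩ hc
  · obtain rfl : μ = h2.choose := by simpa [Value.out] using hμ
    exact hA x _ (h2.choose_spec.symm.subset (Set.mem_singleton _))
  · simp [Value.out] at hμ
  · simp [Value.out] at hμ

theorem Aligned.evolve {c : Config S} {t : ℝ} (h : G.Aligned c t) (d : ℝ) :
    G.Aligned (S.evolve c d) (t + d) :=
  aligned_settle fun _ _ hμ => onLine_add (h _ _ hμ)

theorem Aligned.mem_nodes_evolve {c : Config S} {t : ℝ} (h : G.Aligned c t) {d x : ℝ}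
    (hx : (S.evolve c d x).IsCollision) : (x, t + d) ∈ G.nodes :=
  mem_nodes_of_settle (fun _ hμ => onLine_add (h _ _ hμ)) hx

variable (G)

/-- The nodes are separated as soon as there are two speeds. -/
theorem nodes_separated {α β : M} (hαβ : S.speed α ≠ S.speed β) :
    ∃ ε > 0, ∀ p ∈ G.nodes, ∀ q ∈ G.nodes, dist p q < ε → p = q := by
  -- Nearby nodes have weighted offsets that differ by a multiple of the unit smaller than the unit,
  -- hence lie on the same line of `μ`. Two speeds then determine the node.
  have key : ∀ μ : M, ∃ ε > 0, ∀ p ∈ G.nodes, ∀ q ∈ G.nodes, dist p q < ε →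
      p.1 - q.1 = S.speed μ * (p.2 - q.2) := by
    intro μ
    have hw : (G.weight μ : ℝ) ≠ 0 := by exact_mod_cast G.weight_ne_zero μ
    have hC : 0 < |(G.weight μ : ℝ)| * (1 + |S.speed μ|) := by positivity
    refine ⟨G.unit / (|(G.weight μ : ℝ)| * (1 + |S.speed μ|)), div_pos G.unit_pos hC, ?_⟩
    intro p hp q hq hpq
    rw [lt_div_iff₀ hC] at hpq
    have hmem := AddSubgroup.sub_mem _ (hp μ) (hq μ)
    have e : (G.weight μ : ℝ) * (p.1 - G.origin - S.speed μ * p.2)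
        - G.weight μ * (q.1 - G.origin - S.speed μ * q.2)
        = G.weight μ * ((p.1 - q.1) - S.speed μ * (p.2 - q.2)) := by ring
    rw [e] at hmem
    have h1 : |p.1 - q.1| ≤ dist p q := by
      rw [← Real.dist_eq]; exact le_max_left _ _
    have h2 : |p.2 - q.2| ≤ dist p q := by
      rw [← Real.dist_eq]; exact le_max_right _ _
    have h3 : |(p.1 - q.1) - S.speed μ * (p.2 - q.2)| ≤ dist p q * (1 + |S.speed μ|) :=
      calc _ ≤ |p.1 - q.1| + |S.speed μ * (p.2 - q.2)| := abs_sub _ _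
        _ ≤ dist p q + |S.speed μ| * dist p q := by rw [abs_mul]; gcongr
        _ = _ := by ring
    have h0 := eq_zero_of_mem_zmultiples_of_abs_lt hmem <| by
      rw [abs_mul]
      calc _ ≤ |(G.weight μ : ℝ)| * (dist p q * (1 + |S.speed μ|)) := by gcongr
        _ < _ := by linarith
    linarith [(mul_eq_zero.1 h0).resolve_left hw]
  obtain ⟨ε₁, hε₁, k₁⟩ := key α
  obtain ⟨ε₂, hε₂, k₂⟩ := key β
  refine ⟨min ε₁ ε₂, lt_min hε₁ hε₂, fun p hp q hq hpq => ?_⟩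
  have e₁ := k₁ p hp q hq (hpq.trans_le (min_le_left _ _))
  have e₂ := k₂ p hp q hq (hpq.trans_le (min_le_right _ _))
  have e₃ : p.2 - q.2 = 0 :=
    (mul_eq_zero.1 (by linear_combination e₂ - e₁ :
      (S.speed α - S.speed β) * (p.2 - q.2) = 0)).resolve_left (sub_ne_zero.2 hαβ)
  rw [e₃, mul_zero] at e₁
  exact Prod.ext (sub_eq_zero.1 e₁) (sub_eq_zero.1 e₃)

/-- The times of the nodes are integer multiples of a time quantum. -/
theorem exists_time_quantum {α β : M} (hαβ : S.speed α ≠ S.speed β) :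
    ∃ τ : ℝ, 0 < τ ∧ ∀ x t : ℝ, (x, t) ∈ G.nodes → ∃ k : ℤ, t = k * τ := by
  have hα : (G.weight α : ℝ) ≠ 0 := by exact_mod_cast G.weight_ne_zero α
  have hβ : (G.weight β : ℝ) ≠ 0 := by exact_mod_cast G.weight_ne_zero β
  have hs : S.speed β - S.speed α ≠ 0 := sub_ne_zero.2 hαβ.symm
  -- Obtained by eliminating `x` from the equations of the two lines. Its sign is unknown, hence
  -- `|σ|`.
  set σ : ℝ := G.unit / (G.weight α * G.weight β * (S.speed β - S.speed α)) with hσ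
  have hσ0 : σ ≠ 0 := div_ne_zero G.unit_pos.ne' (by positivity)
  refine ⟨|σ|, abs_pos.2 hσ0, fun x t h => ?_⟩
  obtain ⟨m, hm⟩ := AddSubgroup.mem_zmultiples_iff.1 (h α)
  obtain ⟨n, hn⟩ := AddSubgroup.mem_zmultiples_iff.1 (h β)
  simp only [zsmul_eq_mul] at hm hn
  have e : t = (G.weight β * m - G.weight α * n : ℤ) * σ := by
    rw [hσ]
    field_simp
    push_cast
    linear_combination (G.weight α : ℝ) * hn - (G.weight β : ℝ) * hm
  rcases abs_choice σ with h | h <;> rw [h]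
  · exact ⟨_, e⟩
  · exact ⟨-(G.weight β * m - G.weight α * n), by push_cast at e ⊢; linear_combination e⟩

end Mesh

/-! ### Collision times -/

/-- The time to the next collision of an aligned configuration is a positive number of quanta. -/
theorem delta_eq_of_aligned {S : SignalMachine M} {G : S.Mesh} {τ : ℝ} (hτ : 0 < τ)
    (h_nodes : ∀ x t : ℝ, (x, t) ∈ G.nodes → ∃ k : ℤ, t = k * τ) {c : Config S} {k : ℕ}
    (hc : G.Aligned c (k * τ)) :
    S.delta c = ⊤ ∨ ∃ j : ℕ, 0 < j ∧ S.delta c = ENNReal.ofReal (j * τ) := by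
  classical
  -- Two such signals would meet at a node, so `d` is a difference of two multiples of `τ`. Hence
  -- the infimum is attained.
  have hD : ∀ d ∈ S.meetingDelays c, ∃ j : ℕ, 0 < j ∧ d = j * τ := by
    rintro d ⟨hd, x₁, x₂, μ₁, μ₂, hx, hμ₁, hμ₂, e⟩
    have hs : S.speed μ₁ ≠ S.speed μ₂ := fun h => hx (by rw [h] at e; linarith)
    have l₁ : G.OnLine μ₁ (x₁ + d * S.speed μ₁) (k * τ + d) :=
      Mesh.onLine_add (by rw [add_sub_cancel_right]; exact hc _ _ hμ₁)
    have l₂ : G.OnLine μ₂ (x₁ + d * S.speed μ₁) (k * τ + d) :=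
      Mesh.onLine_add (by rw [e, add_sub_cancel_right]; exact hc _ _ hμ₂)
    obtain ⟨m, hm⟩ := h_nodes _ _ (Mesh.mem_nodes_of_onLine hs l₁ l₂)
    have hd' : d = (m - k : ℤ) * τ := by push_cast; linear_combination hm
    have hpos : 0 < m - k := by
      have : (0 : ℝ) < (m - k : ℤ) := pos_of_mul_pos_left (hd' ▸ hd) hτ.le
      exact_mod_cast this
    obtain ⟨j, hj⟩ := Int.eq_ofNat_of_zero_le hpos.le
    rw [hj] at hd' hpos
    exact ⟨j, by exact_mod_cast hpos, by simpa using hd'⟩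
  by_cases hne : ∃ j : ℕ, (j * τ : ℝ) ∈ S.meetingDelays c
  · right
    refine ⟨Nat.find hne, ?_, le_antisymm (iInf₂_le _ (Nat.find_spec hne)) ?_⟩
    · have h0 := pos_of_mul_pos_left (Nat.find_spec hne).1 hτ.le
      exact_mod_cast h0
    · refine le_iInf₂ fun d hd => ?_
      obtain ⟨j, -, rfl⟩ := hD d hd
      have hj : Nat.find hne ≤ j := Nat.find_min' hne hd
      gcongr
  · left
    refine iInf₂_eq_top.2 fun d hd => ?_
    obtain ⟨j, -, rfl⟩ := hD d hd
    exact absurd ⟨j, hd⟩ hne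

/-- Each step costs at least one quantum, whence `n ≤ k`, the bound that makes the times diverge.
Alignment is claimed only at finite times, since the configuration means nothing after `⊤`. -/
theorem stage_aligned {S : SignalMachine M} {G : S.Mesh} {τ : ℝ} (hτ : 0 < τ)
    (h_nodes : ∀ x t : ℝ, (x, t) ∈ G.nodes → ∃ k : ℤ, t = k * τ) {c₀ : Config S}
    (hc₀ : G.Aligned c₀ 0) (n : ℕ) :
    (S.stage c₀ n).1 = ⊤ ∨ ∃ k : ℕ, n ≤ k ∧ (S.stage c₀ n).1 = ENNReal.ofReal (k * τ) ∧
      G.Aligned (S.stage c₀ n).2 (k * τ) := by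
  induction n with
  | zero => exact Or.inr ⟨0, le_rfl, by simp [stage], by simpa [stage] using hc₀⟩
  | succ n ih =>
    simp only [stage]
    rcases ih with h | ⟨k, hk, hkt, hal⟩
    · left; rw [h, top_add]
    rcases delta_eq_of_aligned hτ h_nodes hal with h | ⟨j, hj, h⟩
    · left; rw [h, add_top]
    · right
      refine ⟨k + j, by lia, ?_, ?_⟩
      · rw [hkt, h, ← ENNReal.ofReal_add (by positivity) (by positivity)]
        congr 1; push_cast; ring
      · rw [h, ENNReal.toReal_ofReal (by positivity)]
        push_cast
        rw [add_mul]
        exact hal.evolve _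

theorem limitTime_eq_top_of_aligned {S : SignalMachine M} {G : S.Mesh} {τ : ℝ} (hτ : 0 < τ)
    (h_nodes : ∀ x t : ℝ, (x, t) ∈ G.nodes → ∃ k : ℤ, t = k * τ) {c₀ : Config S}
    (hc₀ : G.Aligned c₀ 0) : S.limitTime c₀ = ⊤ := by
  refine ENNReal.eq_top_of_forall_nnreal_le fun r => ?_
  obtain ⟨n, hn⟩ := exists_nat_ge ((r : ℝ) / τ)
  refine le_trans ?_ (le_iSup (fun n => (S.stage c₀ n).1) n)
  rcases stage_aligned hτ h_nodes hc₀ n with h | ⟨k, hk, h, -⟩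
  · simp [h]
  · simp only [h]
    rw [← ENNReal.ofReal_coe_nnreal]
    refine ENNReal.ofReal_le_ofReal ?_
    rw [div_le_iff₀ hτ] at hn
    have : (n : ℝ) ≤ k := by exact_mod_cast hk
    nlinarith

theorem diagram_eq_diagramBefore {S : SignalMachine M} {c₀ : Config S}
    (h : S.limitTime c₀ = ⊤) (t : ℝ) : S.diagram c₀ t = S.diagramBefore c₀ t := by
  simp [diagram, h]

/-! ### Finite supports and absence of accumulation values -/

theorem settle_ne_accu (S : SignalMachine M) {A : ℝ → Set M} (hA : {y | (A y).Nonempty}.Finite)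
    (x : ℝ) : S.settle A x ≠ .accu := by
  unfold settle
  split_ifs with _ _ h
  · simp
  · simp
  · exact absurd hA (Set.Infinite.of_accPt h)
  · simp

theorem finite_support_settle (S : SignalMachine M) {A : ℝ → Set M}
    (hA : {y | (A y).Nonempty}.Finite) : (Config.support (S.settle A)).Finite := by
  refine hA.subset fun x hx => ?_
  have h1 := S.settle_ne_accu hA x
  change S.settle A x ≠ .void at hx
  unfold settle at hx h1
  split_ifs at hx h1 with h2 h3
  · exact h2.1.nonempty
  · exact h3.elim fun μ hμ => ⟨μ, hμ.symm.subset (Set.mem_singleton _)⟩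
  · exact absurd rfl h1
  · exact absurd rfl hx

theorem finite_arrivals (S : SignalMachine M) {c : Config S} (hc : c.support.Finite) (d : ℝ) :
    {x | {μ | μ ∈ (c (x - d * S.speed μ)).out}.Nonempty}.Finite := by
  refine (Set.finite_iUnion fun μ : M => hc.image (· + d * S.speed μ)).subset ?_
  rintro x ⟨μ, hμ⟩
  refine Set.mem_iUnion.2 ⟨μ, x - d * S.speed μ, fun h => ?_, by simp⟩
  simp [h, Value.out] at hμ

theorem evolve_ne_accu (S : SignalMachine M) {c : Config S} (hc : c.support.Finite) (d x : ℝ) :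
    S.evolve c d x ≠ .accu :=
  S.settle_ne_accu (S.finite_arrivals hc d) x

theorem finite_support_stage (S : SignalMachine M) {c₀ : Config S} (hc : c₀.support.Finite)
    (n : ℕ) : (S.stage c₀ n).2.support.Finite := by
  induction n with
  | zero => exact hc
  | succ n ih => exact S.finite_support_settle (S.finite_arrivals ih _)

theorem stage_ne_accu (S : SignalMachine M) {c₀ : Config S} (hc : c₀.IsInitial) (n : ℕ) (x : ℝ) :
    (S.stage c₀ n).2 x ≠ .accu := by
  cases n with
  | zero => exact hc.ne_accu x
  | succ n => exact S.evolve_ne_accu (S.finite_support_stage hc.finite_support n) _ x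

theorem diagramBefore_ne_accu (S : SignalMachine M) {c₀ : Config S} (hc : c₀.IsInitial)
    (t x : ℝ) : S.diagramBefore c₀ t x ≠ .accu := by
  unfold diagramBefore
  split_ifs
  · dsimp only
    split_ifs
    · exact S.stage_ne_accu hc _ x
    · exact S.evolve_ne_accu (S.finite_support_stage hc.finite_support _) _ x
  · simp

/-! ### Collisions are nodes -/

/-- `h_init` serves stage `0`: a collision placed in `c₀` may emit fewer than two signals, and then
alignment alone does not make it a node. -/
theorem stage_collision_mem_nodes {S : SignalMachine M} {G : S.Mesh} {τ : ℝ} (hτ : 0 < τ)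
    (h_nodes : ∀ x t : ℝ, (x, t) ∈ G.nodes → ∃ k : ℤ, t = k * τ) {c₀ : Config S}
    (hc₀ : G.Aligned c₀ 0) (h_init : ∀ x ∈ c₀.support, (x, 0) ∈ G.nodes) {n : ℕ}
    (hn : (S.stage c₀ n).1 ≠ ⊤) {x : ℝ} (hx : ((S.stage c₀ n).2 x).IsCollision) :
    (x, (S.stage c₀ n).1.toReal) ∈ G.nodes := by
  cases n with
  | zero =>
    obtain ⟨ρ, hρ⟩ := hx
    exact h_init x (by simp only [stage] at hρ; simp [Config.support, hρ])
  | succ n =>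
    simp only [stage] at hn hx ⊢
    rw [ENNReal.add_ne_top] at hn
    obtain ⟨k, -, hk, hal⟩ := (stage_aligned hτ h_nodes hc₀ n).resolve_left hn.1
    rw [ENNReal.toReal_add hn.1 hn.2, hk, ENNReal.toReal_ofReal (by positivity)]
    exact hal.mem_nodes_evolve hx

theorem diagramBefore_collision_mem_nodes {S : SignalMachine M} {G : S.Mesh} {τ : ℝ} (hτ : 0 < τ)
    (h_nodes : ∀ x t : ℝ, (x, t) ∈ G.nodes → ∃ k : ℤ, t = k * τ) {c₀ : Config S}
    (hc₀ : G.Aligned c₀ 0) (h_init : ∀ x ∈ c₀.support, (x, 0) ∈ G.nodes) {t x : ℝ}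
    (hx : (S.diagramBefore c₀ t x).IsCollision) : (x, t) ∈ G.nodes := by
  unfold diagramBefore at hx
  split_ifs at hx with h
  · dsimp only at hx
    have hn : (S.stage c₀ (Nat.find h.2)).1 ≠ ⊤ :=
      ((Nat.find_spec h.2).1.trans_lt ENNReal.ofReal_lt_top).ne
    split_ifs at hx with ht
    · rw [ht]
      exact stage_collision_mem_nodes hτ h_nodes hc₀ h_init hn hx
    · obtain ⟨k, -, hk, hal⟩ := (stage_aligned hτ h_nodes hc₀ _).resolve_left hn
      have := hal.mem_nodes_evolve hx
      rwa [hk, ENNReal.toReal_ofReal (by positivity), add_sub_cancel] at this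
  · obtain ⟨ρ, hρ⟩ := hx
    cases hρ

/-! ### Construction of the mesh -/

/-- The three speeds and the initial positions of a rational-like machine and configuration span a
mesh whose nodes include the initial positions. -/
theorem exists_mesh (h_three : S.speedCount = 3) (h_speeds : S.RationalLike)
    {c₀ : Config S} (h_init : c₀.IsInitial) (h_dist : c₀.RationalLike) :
    ∃ G : S.Mesh, ∀ x ∈ c₀.support, (x, 0) ∈ G.nodes := by
  classical
  obtain ⟨o, ℓ, hℓ, hx⟩ : ∃ o ℓ : ℝ, 0 < ℓ ∧ ∀ x ∈ c₀.support, ∃ n : ℤ, x - o = n * ℓ := by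
    rcases c₀.support.eq_empty_or_nonempty with he | ⟨o, ho⟩
    · exact ⟨0, 1, one_pos, by simp [he]⟩
    obtain ⟨ℓ, hℓ, h⟩ := exists_unit_of_pairwise_commensurate
      (h_init.finite_support.image (dist · o)) <| by
        rintro _ ⟨x, hx, rfl⟩ _ ⟨y, hy, rfl⟩
        exact h_dist x hx o ho y hy o ho
    refine ⟨o, ℓ, hℓ, fun x hx => ?_⟩
    obtain ⟨n, hn⟩ := h _ ⟨x, hx, rfl⟩
    dsimp only at hn
    rw [Real.dist_eq] at hn
    rcases abs_choice (x - o) with h | h <;> rw [h] at hn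
    · exact ⟨n, hn⟩
    · exact ⟨-n, by push_cast; linear_combination -hn⟩
  obtain ⟨u, hu, hs⟩ := exists_unit_of_pairwise_commensurate (Set.finite_range S.speed) <| by
    rintro _ ⟨μ, rfl⟩ _ ⟨ν, rfl⟩
    exact h_speeds μ ν
  obtain ⟨a, b, c, hab, hac, hbc, hr⟩ := Set.ncard_eq_three.1 h_three
  obtain ⟨i, hi⟩ := hs a (by simp [hr])
  obtain ⟨j, hj⟩ := hs b (by simp [hr])
  obtain ⟨k, hk⟩ := hs c (by simp [hr])
  have hij : i ≠ j := by rintro rfl; exact hab (hi.trans hj.symm)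
  have hik : i ≠ k := by rintro rfl; exact hac (hi.trans hk.symm)
  have hjk : j ≠ k := by rintro rfl; exact hbc (hj.trans hk.symm)
  have hM : ∀ μ, S.speed μ = a ∨ S.speed μ = b ∨ S.speed μ = c := fun μ => by
    simpa [hr] using Set.mem_range_self (f := S.speed) μ
  -- Each weight is the difference of the other two speeds, in cyclic order and in units of `u`; it
  -- is nonzero because the speeds are distinct.
  let w : ℝ → ℤ := fun v => if v = a then j - k else if v = b then k - i else i - j
  have wa : w a = j - k := by simp [w]
  have wb : w b = k - i := by simp [w, hab.symm]
  have wc : w c = i - j := by simp [w, hac.symm, hbc.symm]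
  have hsum : ∀ y t : ℝ, w a * (y - a * t) + w b * (y - b * t) + w c * (y - c * t) = 0 := by
    intro y t
    rw [wa, wb, wc, hi, hj, hk]
    push_cast
    ring
  have hclosed : ∀ p q r : ℝ, p + q + r = 0 → p ∈ AddSubgroup.zmultiples ℓ →
      q ∈ AddSubgroup.zmultiples ℓ → r ∈ AddSubgroup.zmultiples ℓ := by
    intro p q r h hp hq
    rw [show r = -(p + q) by linarith]
    exact neg_mem (add_mem hp hq)
  refine ⟨⟨o, ℓ, fun μ => w (S.speed μ), hℓ, fun μ => ?_, fun μ ν κ hne y t hμ hν => ?_⟩,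
    fun x hxs μ => ?_⟩
  · rcases hM μ with h | h | h <;> simp only [h, wa, wb, wc] <;> lia
  · have := hsum y t
    -- Either `κ` shares its speed with `μ` or `ν`, or it has the third speed and `hsum` applies.
    rcases hM μ with h | h | h <;> rcases hM ν with h' | h' | h' <;>
      rcases hM κ with h'' | h'' | h'' <;> rw [h] at hμ hne <;> rw [h'] at hν hne <;> rw [h''] <;>
      first
      | exact absurd rfl hne
      | exact hμ
      | exact hν
      | exact hclosed _ _ _ (by linarith) hμ hν
  -- At time `0` the offset `x - o` is the same for all speeds.
  · obtain ⟨n, hn⟩ := hx x hxs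
    refine AddSubgroup.mem_zmultiples_iff.2 ⟨w (S.speed μ) * n, ?_⟩
    simp [hn, mul_assoc]

end Mesh

end SignalMachine

theorem mainTheorem1 {M : Type*} [Finite M] (S : SignalMachine M)
    (h_three : S.speedCount = 3) (h_speeds : S.RationalLike)
    (c₀ : SignalMachine.Config S) (h_init : c₀.IsInitial) (h_dist : c₀.RationalLike) :
    S.limitTime c₀ = ⊤ ∧
      (∀ t : ℝ, 0 ≤ t → ∀ x : ℝ, S.diagram c₀ t x ≠ SignalMachine.Value.accu) ∧
      (∀ p : ℝ × ℝ, ¬ AccPt p (Filter.principal (S.collisionPoints c₀))) := by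
  obtain ⟨G, hG⟩ := S.exists_mesh h_three h_speeds h_init h_dist
  obtain ⟨α, β, hαβ⟩ : ∃ α β, S.speed α ≠ S.speed β := by
    obtain ⟨a, b, c, hab, -, -, hr⟩ := Set.ncard_eq_three.1 h_three
    obtain ⟨α, rfl⟩ : a ∈ Set.range S.speed := by simp [hr]
    obtain ⟨β, rfl⟩ : b ∈ Set.range S.speed := by simp [hr]
    exact ⟨α, β, hab⟩
  obtain ⟨τ, hτ, h_nodes⟩ := G.exists_time_quantum hαβ
  have hc₀ : G.Aligned c₀ 0 := fun x μ hμ =>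
    hG x (fun h => by simp [h, SignalMachine.Value.out] at hμ) μ
  have h_top := SignalMachine.limitTime_eq_top_of_aligned hτ h_nodes hc₀
  refine ⟨h_top, fun t _ x => ?_, fun p hp => ?_⟩
  · rw [SignalMachine.diagram_eq_diagramBefore h_top]
    exact S.diagramBefore_ne_accu h_init t x
  · obtain ⟨ε, hε, hsep⟩ := G.nodes_separated hαβ
    refine not_accPt_of_separated hε hsep p (hp.mono (Filter.principal_mono.2 fun q hq => ?_))
    have hq' := hq.2
    rw [SignalMachine.diagram_eq_diagramBefore h_top] at hq'
    exact SignalMachine.diagramBefore_collision_mem_nodes hτ h_nodes hc₀ hG hq'
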